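/- Let $d\le\tilde d$, let $\mathcal Z\subset\mathbb R^{\tilde d}$ be compact, and let $\mathcal Z$ be a $d$-dimensional differentiable manifold: every point of $\mathcal Z$ has a relatively open neighbourhood $U\subseteq\mathcal Z$ for which there are an open set $V\subset\mathbb R^d$ and a homeomorphism $\psi:V\to U$ that is continuously differentiable as an $\mathbb R^{\tilde d}$-valued map and whose inverse locally extends to continuously differentiable maps on open subsets of $\mathbb R^{\tilde d}$. Let $\mu$ be a Borel probability measure on $\mathcal Z$. Let $X_1,\dots,X_p$ ($p\ge1$) be real-valued square-integrable random fields indexed by $\mathcal Z$ such that, for each $j$, $\mathbb E[X_j(z)X_j(z')]$ is continuous on $\mathcal Z\times\mathcal Z$, and let $$f(z,z')=\frac1p\sum_{j=1}^p\mathbb E[X_j(z)X_j(z')].$$ Let $\lambda_1\ge\lambda_2\ge\dots\ge0$ and functions $u_1,u_2,\dots$ on $\mathcal Z$, those with $\lambda_k>0$ being orthonormal in $L_2(\mu)$, give a Mercer expansion $f(z,z')=\sum_{k\ge1}\lambda_ku_k(z)u_k(z')$, converging absolutely and uniformly; let $\phi(z)=(\lambda_k^{1/2}u_k(z))_{k\ge1}\in\ell_2$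 and $\mathcal M=\phi(\mathcal Z)\subset\ell_2$. Assume that for all $z\ne z'$ in $\mathcal Z$ there is $\xi\in\mathcal Z$ with $f(z,\xi)\ne f(z',\xi)$. Assume also that $f$ extends to $\widetilde{\mathcal Z}\times\widetilde{\mathcal Z}$ for some open $\widetilde{\mathcal Z}\subset\mathbb R^{\tilde d}$ with $\mathcal Z\subset\widetilde{\mathcal Z}$, in such a way that for all $1\le i,j\le\tilde d$ the mixed partial derivative $\partial^2f/\partial z_i\partial z'_j$ exists and is continuous on $\widetilde{\mathcal Z}\times\widetilde{\mathcal Z}$, and that for every $\xi\in\mathcal Z$ the matrix $\mathbf H_\xi$ with elements $(\mathbf H_\xi)_{ij}=\frac{\partial^2f}{\partial z_i\partial z'_j}\big|_{(\xi,\xi)}$ is (symmetric) positive-definite. A curve in $\mathcal Z$ (in $\mathcal M$) is a map $[0,1]\to\mathcal Z$ (resp. $[0,1]\to\mathcal M$) that is continuously differentiable as an $\mathbb R^{\tilde d}$-valued (resp. $\ell_2$-valued) map; a dot denotes its derivative. Then $\phi$ is a homeomorphism of $\mathcal Z$ onto $\mathcal M$, and: (i) if $\eta$ is a curve in $\mathcal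 Z$, then $t\mapsto\phi(\eta_t)$ is a curve in $\mathcal M$; (ii) if $\gamma$ is a curve in $\mathcal M$, then $t\mapsto\phi^{-1}(\gamma_t)$ is a curve in $\mathcal Z$; (iii) if either $\eta$ is a curve in $\mathcal Z$ and $\gamma_t=\phi(\eta_t)$, or $\gamma$ is a curve in $\mathcal M$ and $\eta_t=\phi^{-1}(\gamma_t)$, then $$\int_0^1\|\dot\gamma_t\|_2\,dt=\int_0^1\langle\dot\eta_t,\mathbf H_{\eta_t}\dot\eta_t\rangle^{1/2}\,dt.$$ Moreover, $\mathbf H$ is the metric pulled back from $\ell_2$ by $\phi$: if $\eta,\eta'$ are curves in $\mathcal Z$ with $\eta_t=\eta'_s$, and $\gamma=\phi(\eta)$, $\gamma'=\phi(\eta')$, then $\langle\dot\gamma_t,\dot\gamma'_s\rangle_2=\langle\dot\eta_t,\mathbf H_{\eta_t}\dot\eta'_s\rangle$. -/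

import Mathlib

open MeasureTheory Set Filter Topology

/-! ### Manifolds in Euclidean space -/

/-- A map `g` is `C¹` on an arbitrary set `U` of a Euclidean space if near every point of `U` it
agrees on `U` with a map that is continuously differentiable on an open set. -/
def IsC1OnArbitrary {m n : ℕ} (U : Set (EuclideanSpace ℝ (Fin m)))
    (g : EuclideanSpace ℝ (Fin m) → EuclideanSpace ℝ (Fin n)) : Prop :=
  ∀ x ∈ U, ∃ (W : Set (EuclideanSpace ℝ (Fin m)))
    (g' : EuclideanSpace ℝ (Fin m) → EuclideanSpace ℝ (Fin n)),
    IsOpen W ∧ x ∈ W ∧ ContDiffOn ℝ 1 g' W ∧ ∀ y ∈ W ∩ U, g' y = g y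

/-- `ψ : V → U` is a diffeomorphism, with inverse `χ`, between the open set `V` and the
arbitrary set `U`: a homeomorphism that is `C¹` on `V` and whose inverse is `C¹` on `U`. -/
structure IsC1Diffeo {m n : ℕ} (V : Set (EuclideanSpace ℝ (Fin m)))
    (U : Set (EuclideanSpace ℝ (Fin n)))
    (ψ : EuclideanSpace ℝ (Fin m) → EuclideanSpace ℝ (Fin n))
    (χ : EuclideanSpace ℝ (Fin n) → EuclideanSpace ℝ (Fin m)) : Prop where
  isOpen : IsOpen V
  mapsTo : MapsTo ψ V U
  mapsTo_inv : MapsTo χ U V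
  invOn : InvOn χ ψ V U
  continuousOn : ContinuousOn ψ V
  continuousOn_inv : ContinuousOn χ U
  contDiffOn : ContDiffOn ℝ 1 ψ V
  contDiff_inv : IsC1OnArbitrary U χ

/-- `A ⊆ ℝⁿ` is a `d`-dimensional differentiable manifold: every point of `A` has a relatively
open neighbourhood in `A` that is diffeomorphic to an open subset of `ℝᵈ`. -/
def IsDifferentiableManifold {n : ℕ} (d : ℕ) (A : Set (EuclideanSpace ℝ (Fin n))) : Prop :=
  ∀ a ∈ A, ∃ (O : Set (EuclideanSpace ℝ (Fin n))) (V : Set (EuclideanSpace ℝ (Fin d)))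
    (ψ : EuclideanSpace ℝ (Fin d) → EuclideanSpace ℝ (Fin n))
    (χ : EuclideanSpace ℝ (Fin n) → EuclideanSpace ℝ (Fin d)),
    IsOpen O ∧ a ∈ O ∧ IsC1Diffeo V (O ∩ A) ψ χ

/-! ### The mean correlation kernel and its Mercer feature map -/

/-- The mean correlation kernel `f(z, z') = p⁻¹ ∑ⱼ E[Xⱼ(z) Xⱼ(z')]` of random fields
`X₁, …, X_p` indexed by `S`. -/
noncomputable def meanCorrelationKernel {Ω S : Type*} [MeasurableSpace Ω] (P : Measure Ω)
    {p : ℕ} (X : Fin p → S → Ω → ℝ) (z z' : S) : ℝ :=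
  (1 / (p : ℝ)) * ∑ j, ∫ ω, X j z ω * X j z' ω ∂P

/-- `(lam, u)` is a Mercer system of the kernel `f` with respect to `μ`: `lam` is nonnegative and
nonincreasing, `u` is orthonormal in `L₂(μ)` and `f(z, z') = ∑ₖ lamₖ uₖ(z) uₖ(z')`, absolutely
and uniformly. Finite systems (which occur when `L₂(μ)` has finite dimension) are padded by
`lamₖ = 0`, and nothing is asked of the functions `uₖ` with `lamₖ = 0`. -/
structure IsMercerSystem {S : Type*} [MeasurableSpace S] (μ : Measure S) (f : S → S → ℝ)
    (lam : ℕ → ℝ) (u : ℕ → S → ℝ) : Prop where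
  nonneg : ∀ k, 0 ≤ lam k
  antitone : Antitone lam
  memLp : ∀ k, lam k ≠ 0 → MemLp (u k) 2 μ
  orthonormal : ∀ k l, lam k ≠ 0 → lam l ≠ 0 →
    ∫ z, u k z * u l z ∂μ = if k = l then 1 else 0
  hasSum : ∀ z z', HasSum (fun k => lam k * u k z * u k z') (f z z')
  uniform : TendstoUniformly
    (fun (N : ℕ) (q : S × S) => ∑ k ∈ Finset.range N, lam k * u k q.1 * u k q.2)
    (fun q => f q.1 q.2) atTop

theorem IsMercerSystem.memℓp {S : Type*} [MeasurableSpace S] {μ : Measure S} {f : S → S → ℝ}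
    {lam : ℕ → ℝ} {u : ℕ → S → ℝ} (h : IsMercerSystem μ f lam u) (z : S) :
    Memℓp (fun k => √(lam k) * u k z) 2 := by
  refine memℓp_gen ?_
  refine (h.hasSum z z).summable.congr fun k => ?_
  have h1 := Real.mul_self_sqrt (h.nonneg k)
  simp only [ENNReal.toReal_ofNat, Real.rpow_ofNat, Real.norm_eq_abs, sq_abs]
  rw [mul_pow, pow_two √(lam k), h1]
  ring

/-- The Mercer feature map `φ(z) = (lamₖ^{1/2} uₖ(z))ₖ`, with values in `ℓ₂`. -/
noncomputable def mercerFeatureMap {S : Type*} [MeasurableSpace S] {μ : Measure S}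
    {f : S → S → ℝ} {lam : ℕ → ℝ} {u : ℕ → S → ℝ} (h : IsMercerSystem μ f lam u) (z : S) :
    lp (fun _ : ℕ => ℝ) 2 :=
  ⟨fun k => √(lam k) * u k z, h.memℓp z⟩

/-! ### Mixed partial derivatives of the kernel -/

/-- The partial derivative `∂F/∂z'ⱼ` at `(z, z')`. -/
noncomputable def partialSnd {n : ℕ}
    (F : EuclideanSpace ℝ (Fin n) → EuclideanSpace ℝ (Fin n) → ℝ) (j : Fin n)
    (z z' : EuclideanSpace ℝ (Fin n)) : ℝ :=
  lineDeriv ℝ (fun w' => F z w') z' (EuclideanSpace.single j 1)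

/-- The mixed partial derivative `∂²F/∂zᵢ∂z'ⱼ` at `(z, z')`. -/
noncomputable def mixedPartial {n : ℕ}
    (F : EuclideanSpace ℝ (Fin n) → EuclideanSpace ℝ (Fin n) → ℝ) (i j : Fin n)
    (z z' : EuclideanSpace ℝ (Fin n)) : ℝ :=
  lineDeriv ℝ (fun w => partialSnd F j w z') z (EuclideanSpace.single i 1)

/-- The matrix `H_ξ` of the mixed partial derivatives `∂²F/∂zᵢ∂z'ⱼ` at `(ξ, ξ)`. -/
noncomputable def metricMatrix {n : ℕ}
    (F : EuclideanSpace ℝ (Fin n) → EuclideanSpace ℝ (Fin n) → ℝ)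
    (ξ : EuclideanSpace ℝ (Fin n)) : Matrix (Fin n) (Fin n) ℝ :=
  Matrix.of fun i j => mixedPartial F i j ξ ξ

/-- The bilinear form `⟨v, H_ξ w⟩`. -/
noncomputable def metricForm {n : ℕ}
    (F : EuclideanSpace ℝ (Fin n) → EuclideanSpace ℝ (Fin n) → ℝ)
    (ξ v w : EuclideanSpace ℝ (Fin n)) : ℝ :=
  inner ℝ v (Matrix.toEuclideanLin (metricMatrix F ξ) w)

/-- `F` extends the kernel `f` from `Z × Z` to `Zt × Zt`, where `Zt ⊇ Z` is open, all mixed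
partial derivatives `∂²F/∂zᵢ∂z'ⱼ` exist and are continuous on `Zt × Zt`, and the matrix `H_ξ` is
positive-definite for every `ξ ∈ Z`. (Values of `F` outside `Zt × Zt` play no role.) -/
structure IsKernelExtension {n : ℕ} (Z : Set (EuclideanSpace ℝ (Fin n))) (f : Z → Z → ℝ)
    (Zt : Set (EuclideanSpace ℝ (Fin n)))
    (F : EuclideanSpace ℝ (Fin n) → EuclideanSpace ℝ (Fin n) → ℝ) : Prop where
  isOpen : IsOpen Zt
  subset : Z ⊆ Zt
  extends_kernel : ∀ z z' : Z, F z z' = f z z'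
  exists_partial : ∀ j, ∀ z ∈ Zt, ∀ z' ∈ Zt,
    LineDifferentiableAt ℝ (fun w' => F z w') z' (EuclideanSpace.single j 1)
  exists_mixed : ∀ i j, ∀ z ∈ Zt, ∀ z' ∈ Zt,
    LineDifferentiableAt ℝ (fun w => partialSnd F j w z') z (EuclideanSpace.single i 1)
  continuous_mixed : ∀ i j, ContinuousOn
    (fun q : EuclideanSpace ℝ (Fin n) × EuclideanSpace ℝ (Fin n) => mixedPartial F i j q.1 q.2)
    (Zt ×ˢ Zt)
  posDef : ∀ ξ ∈ Z, (metricMatrix F ξ).PosDef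

/-! ### Curves -/

/-- The derivative at `t` of a curve defined on `[0, 1]` (one-sided at the end points). -/
noncomputable def velocity {E : Type*} [NormedAddCommGroup E] [NormedSpace ℝ E] (c : ℝ → E)
    (t : ℝ) : E :=
  derivWithin c (Icc 0 1) t

/-- `c`, as a function on `[0, 1]`, is a continuously differentiable curve. (Values of `c`
outside `[0, 1]` play no role.) -/
def IsC1Curve {E : Type*} [NormedAddCommGroup E] [NormedSpace ℝ E] (c : ℝ → E) : Prop :=
  ContinuousOn c (Icc 0 1) ∧ DifferentiableOn ℝ c (Icc 0 1) ∧
    ContinuousOn (velocity c) (Icc 0 1)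

/-!
The Mercer feature map satisfies `⟨φ z, φ z'⟩ = f(z, z')`, so that the inner product of two
increments `φ x - φ y` and `φ x' - φ y'` is a second difference of the kernel. Since the mixed
partial derivatives are continuous, this second difference is `⟨x - y, H_ξ (x' - y')⟩` up to an error
`o(‖x - y‖ ‖x' - y'‖)` when the four points tend to `ξ`
(`IsKernelExtension.exists_second_difference_le`). Consequently, for `η` in `Z` and `γ = φ ∘ η`, the
inner products of difference quotients of `γ` near `t` are asymptotically those of difference
quotients of `η` in the form `H` at `η t` (`isGramEquivalent_slope`).

This relation transports convergence in both directions. Write `q`, `q'` for two difference quotients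
of `η` over pairs of parameters near `t`, and `Q`, `Q'` for those of `γ`. Expanding `‖Q - Q'‖²`
gives `⟨q - q', H (q - q')⟩` up to a small error. So if the quotients of `η` are Cauchy, those of `γ`
are too, and the converse holds because `H` is positive definite
(`IsGramEquivalent.exists_tendsto`, `IsGramEquivalent.exists_tendsto_of_coercive`). A curve on
`[0, 1]` is continuously differentiable if and only if its difference quotients over pairs of distinct
parameters converge as both parameters tend to the same `t` (`IsC1Curve.tendsto_slope`,
`isC1Curve_of_tendsto_slope`), which gives the correspondence of curves. The limit of the relation is
the identity of inner products of velocities, and applied to a single curve it gives the length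
formula. That `φ` is an embedding follows from the continuity of the kernel, the separation hypothesis
and the compactness of `Z`.
-/

/-! ### Second differences and mixed partial derivatives -/

/-- Mean value inequality on a cube, from directional derivatives along the coordinate axes only:
neither continuity nor total differentiability of `g` is assumed. The points `x` and `y` may differ
only in the coordinates in `s`, which are changed one at a time. -/
theorem abs_sub_sub_sum_le_of_lineDeriv {n : ℕ} {g : EuclideanSpace ℝ (Fin n) → ℝ}
    {ξ : EuclideanSpace ℝ (Fin n)} {δ ε : ℝ} {c : Fin n → ℝ}
    (hd : ∀ i x, (∀ k, |x k - ξ k| < δ) →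
      LineDifferentiableAt ℝ g x (EuclideanSpace.single i 1))
    (hb : ∀ i x, (∀ k, |x k - ξ k| < δ) →
      |lineDeriv ℝ g x (EuclideanSpace.single i 1) - c i| ≤ ε)
    (s : Finset (Fin n)) : ∀ x y : EuclideanSpace ℝ (Fin n), (∀ k, |x k - ξ k| < δ) →
      (∀ k, |y k - ξ k| < δ) → (∀ i ∉ s, x i = y i) →
      |g x - g y - ∑ i ∈ s, c i * (x i - y i)| ≤ ε * ∑ i ∈ s, |x i - y i| := by
  classical
  induction s using Finset.induction_on with
  | empty =>
    intro x y _ _ h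
    have : x = y := by ext i; exact h i (by simp)
    simp [this]
  | insert a s ha ih =>
    intro x y hx hy h
    set e : EuclideanSpace ℝ (Fin n) := EuclideanSpace.single a 1 with he
    -- `m` has the coordinate `a` of `y` and all other coordinates of `x`
    set m : EuclideanSpace ℝ (Fin n) := x + (y a - x a) • e with hm
    have hma : ∀ r : ℝ, (m + r • e) a = y a + r := by
      intro r; simp [hm, he]
    have hmk : ∀ r : ℝ, ∀ k ≠ a, (m + r • e) k = x k := by
      intro r k hk; simp [hm, he, hk]
    have hm0 : m + (0 : ℝ) • e = m := by simp
    have hmx : m + (x a - y a) • e = x := by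
      ext k
      by_cases hk : k = a
      · subst hk; rw [hma]; ring
      · rw [hmk _ _ hk]
    have hcube : ∀ r ∈ uIcc 0 (x a - y a), ∀ k, |(m + r • e) k - ξ k| < δ := by
      intro r hr k
      by_cases hk : k = a
      · subst hk
        rw [hma]
        have h1 := abs_lt.1 (hx k)
        have h2 := abs_lt.1 (hy k)
        rw [abs_lt]
        rcases mem_uIcc.1 hr with h3 | h3 <;> constructor <;> linarith [h3.1, h3.2]
      · rw [hmk _ _ hk]; exact hx k
    have hline : |g x - g m - c a * (x a - y a)| ≤ ε * |x a - y a| := by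
      have hder : ∀ r ∈ uIcc 0 (x a - y a), HasDerivWithinAt (fun r => g (m + r • e) - c a * r)
          (lineDeriv ℝ g (m + r • e) e - c a) (uIcc 0 (x a - y a)) r := by
        intro r hr
        -- a line derivative is a derivative at `0`, which is translated to `r`
        have h1 : HasDerivAt (fun w => g (m + r • e + w • e)) (lineDeriv ℝ g (m + r • e) e)
            (-r + r) := by
          rw [neg_add_cancel]
          exact (hd a _ (hcube r hr)).hasLineDerivAt
        have h2 := h1.comp_const_add (-r) r
        have h3 : (fun w => g (m + r • e + (-r + w) • e)) = fun w => g (m + w • e) := by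
          funext w
          congr 1
          module
        rw [h3] at h2
        have h4 := (hasDerivAt_id r).const_mul (c a)
        rw [mul_one] at h4
        exact (h2.sub h4).hasDerivWithinAt
      have h5 := (convex_uIcc (0 : ℝ) (x a - y a)).norm_image_sub_le_of_norm_hasDerivWithin_le hder
        (fun r hr => hb a _ (hcube r hr)) left_mem_uIcc right_mem_uIcc
      rw [hmx, hm0, sub_zero, Real.norm_eq_abs, Real.norm_eq_abs] at h5
      convert h5 using 2
      ring
    have hmk' : ∀ k ≠ a, m k = x k := fun k hk => by rw [← hm0]; exact hmk 0 k hk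
    have hm_cube : ∀ k, |m k - ξ k| < δ := by
      have := hcube 0 left_mem_uIcc
      rwa [hm0] at this
    have hrest := ih m y hm_cube hy (by
      intro i hi
      by_cases hia : i = a
      · subst hia; rw [← hm0, hma, add_zero]
      · rw [hmk' i hia]
        exact h i (by simp [hi, hia]))
    have hsa : ∀ i ∈ s, m i = x i := fun i hi => hmk' i (fun h => ha (h ▸ hi))
    have hsum₁ : ∑ i ∈ s, c i * (m i - y i) = ∑ i ∈ s, c i * (x i - y i) :=
      Finset.sum_congr rfl fun i hi => by rw [hsa i hi]
    have hsum₂ : ∑ i ∈ s, |m i - y i| = ∑ i ∈ s, |x i - y i| :=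
      Finset.sum_congr rfl fun i hi => by rw [hsa i hi]
    rw [hsum₁, hsum₂] at hrest
    rw [Finset.sum_insert ha, Finset.sum_insert ha]
    calc _ = |(g x - g m - c a * (x a - y a)) + (g m - g y - ∑ i ∈ s, c i * (x i - y i))| := by
            congr 1; ring
      _ ≤ _ := abs_add_le _ _
      _ ≤ _ := add_le_add hline hrest
      _ = _ := by ring

theorem metricForm_eq_sum {n : ℕ}
    (F : EuclideanSpace ℝ (Fin n) → EuclideanSpace ℝ (Fin n) → ℝ)
    (ξ v w : EuclideanSpace ℝ (Fin n)) :
    metricForm F ξ v w = ∑ j, (∑ i, mixedPartial F i j ξ ξ * v i) * w j := by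
  simp only [metricForm, PiLp.inner_apply, Matrix.toLpLin_apply, Matrix.mulVec, dotProduct,
    metricMatrix, Matrix.of_apply, RCLike.inner_apply, conj_trivial, Finset.sum_mul]
  rw [Finset.sum_comm]
  exact Finset.sum_congr rfl fun i _ => Finset.sum_congr rfl fun j _ => by ring

theorem EuclideanSpace.sum_abs_le {n : ℕ} (v : EuclideanSpace ℝ (Fin n)) :
    ∑ i, |v i| ≤ n * ‖v‖ := by
  calc ∑ i, |v i| ≤ ∑ _i : Fin n, ‖v‖ := Finset.sum_le_sum fun i _ => PiLp.norm_apply_le v i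
    _ = n * ‖v‖ := by simp

/-- The second difference of the kernel near `(ξ, ξ)` is the metric form of the increments, up to a
relative error. The inner application of the mean value inequality is to the partial derivatives
`∂F/∂z'ⱼ` as functions of `z`, the outer one to `z' ↦ F(x, z') - F(y, z')`. -/
theorem IsKernelExtension.exists_second_difference_le {n : ℕ}
    {Z : Set (EuclideanSpace ℝ (Fin n))} {f : Z → Z → ℝ} {Zt : Set (EuclideanSpace ℝ (Fin n))}
    {F : EuclideanSpace ℝ (Fin n) → EuclideanSpace ℝ (Fin n) → ℝ}
    (hF : IsKernelExtension Z f Zt F) {ξ : EuclideanSpace ℝ (Fin n)} (hξ : ξ ∈ Zt) {ε : ℝ}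
    (hε : 0 < ε) :
    ∀ᶠ U in (𝓝 ξ).smallSets, ∀ x ∈ U, ∀ y ∈ U, ∀ x' ∈ U, ∀ y' ∈ U,
      |F x x' - F y x' - (F x y' - F y y') - metricForm F ξ (x - y) (x' - y')| ≤
        ε * (‖x - y‖ * ‖x' - y'‖) := by
  -- each of the two mean value inequalities loses a factor `n`, from `‖v‖₁ ≤ n ‖v‖₂`
  set ε₁ : ℝ := ε / ((n : ℝ) ^ 2 + 1) with hε₁
  have hε₁0 : 0 < ε₁ := by positivity
  have hmix : ∀ᶠ q in 𝓝 (ξ, ξ), ∀ i j,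
      |mixedPartial F i j q.1 q.2 - mixedPartial F i j ξ ξ| ≤ ε₁ := by
    simp only [eventually_all]
    intro i j
    have h1 := (hF.continuous_mixed i j).continuousAt
      ((hF.isOpen.prod hF.isOpen).mem_nhds ⟨hξ, hξ⟩ : Zt ×ˢ Zt ∈ 𝓝 (ξ, ξ))
    filter_upwards [Metric.tendsto_nhds.1 h1 ε₁ hε₁0] with q hq
    exact hq.le
  -- a cube around `ξ`, inside `Zt`, on whose square the mixed partials are almost constant
  obtain ⟨δ, hδ0, hδ⟩ : ∃ δ > 0, ∀ x z : EuclideanSpace ℝ (Fin n), (∀ k, |x k - ξ k| < δ) →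
      (∀ k, |z k - ξ k| < δ) → x ∈ Zt ∧ z ∈ Zt ∧
        ∀ i j, |mixedPartial F i j x z - mixedPartial F i j ξ ξ| ≤ ε₁ := by
    have hZt : ∀ᶠ q in 𝓝 (ξ, ξ), q ∈ Zt ×ˢ Zt :=
      (hF.isOpen.prod hF.isOpen).mem_nhds ⟨hξ, hξ⟩
    rw [nhds_prod_eq] at hmix hZt
    obtain ⟨U, hU, hU'⟩ := mem_prod_self_iff.1 (hmix.and hZt)
    obtain ⟨r, hr, hrU⟩ := Metric.mem_nhds_iff.1 hU
    refine ⟨r / (n + 1), by positivity, fun x z hx hz => ?_⟩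
    have key : ∀ x : EuclideanSpace ℝ (Fin n), (∀ k, |x k - ξ k| < r / (n + 1)) → x ∈ U := by
      intro x hx
      apply hrU
      rw [mem_ball_iff_norm, EuclideanSpace.norm_eq, Real.sqrt_lt' hr]
      calc ∑ i, ‖(x - ξ) i‖ ^ 2 ≤ ∑ _i : Fin n, (r / (n + 1)) ^ 2 :=
            Finset.sum_le_sum fun i _ => pow_le_pow_left₀ (norm_nonneg _) (hx i).le 2
        _ = (n / (n + 1) ^ 2) * r ^ 2 := by
            simp only [Finset.sum_const, Finset.card_univ, Fintype.card_fin, nsmul_eq_mul, div_pow]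
            ring
        _ < 1 * r ^ 2 := by
            apply mul_lt_mul_of_pos_right _ (by positivity)
            rw [div_lt_one (by positivity)]
            have : (0 : ℝ) ≤ n := n.cast_nonneg
            nlinarith
        _ = r ^ 2 := one_mul _
    have := hU' (mk_mem_prod (key x hx) (key z hz))
    exact ⟨this.2.1, this.2.2, this.1⟩
  rw [eventually_smallSets]
  refine ⟨Metric.ball ξ δ, Metric.ball_mem_nhds ξ hδ0, fun U hU x hx y hy x' hx' y' hy' => ?_⟩
  have hball : ∀ x ∈ U, ∀ k, |x k - ξ k| < δ := fun x hx k =>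
    (PiLp.norm_apply_le (x - ξ) k).trans_lt (mem_ball_iff_norm.1 (hU hx))
  have hinner : ∀ j (z : EuclideanSpace ℝ (Fin n)), (∀ k, |z k - ξ k| < δ) →
      |partialSnd F j x z - partialSnd F j y z - ∑ i, mixedPartial F i j ξ ξ * (x i - y i)| ≤
        ε₁ * ∑ i, |x i - y i| := by
    intro j z hz
    refine abs_sub_sub_sum_le_of_lineDeriv (g := fun w => partialSnd F j w z)
      (fun i w hw => ?_) (fun i w hw => ?_) Finset.univ x y (hball x hx) (hball y hy) (by simp)
    · have := hδ w z hw hz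
      exact hF.exists_mixed i j w this.1 z this.2.1
    · exact (hδ w z hw hz).2.2 i j
  have hxt := fun z hz => hδ x z (hball x hx) hz
  have hyt := fun z hz => hδ y z (hball y hy) hz
  have hline : ∀ j (z : EuclideanSpace ℝ (Fin n)), (∀ k, |z k - ξ k| < δ) →
      HasLineDerivAt ℝ (fun w => F x w - F y w) (partialSnd F j x z - partialSnd F j y z) z
        (EuclideanSpace.single j 1) := fun j z hz =>
    HasDerivAt.sub (hF.exists_partial j x (hxt z hz).1 z (hxt z hz).2.1).hasLineDerivAt
      (hF.exists_partial j y (hyt z hz).1 z (hyt z hz).2.1).hasLineDerivAt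
  have houter := abs_sub_sub_sum_le_of_lineDeriv (g := fun w => F x w - F y w) (ξ := ξ) (δ := δ)
    (c := fun j => ∑ i, mixedPartial F i j ξ ξ * (x i - y i)) (ε := ε₁ * ∑ i, |x i - y i|)
    (fun j z hz => (hline j z hz).lineDifferentiableAt)
    (fun j z hz => by rw [(hline j z hz).lineDeriv]; exact hinner j z hz)
    Finset.univ x' y' (hball x' hx') (hball y' hy') (by simp)
  rw [metricForm_eq_sum]
  refine houter.trans ?_
  have h1 := EuclideanSpace.sum_abs_le (x - y)
  have h2 := EuclideanSpace.sum_abs_le (x' - y')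
  calc (ε₁ * ∑ i, |x i - y i|) * ∑ i, |x' i - y' i|
      ≤ ε₁ * (n * ‖x - y‖) * (n * ‖x' - y'‖) := by
        gcongr
        · exact h1
        · exact h2
    _ = (ε₁ * (n : ℝ) ^ 2) * (‖x - y‖ * ‖x' - y'‖) := by ring
    _ ≤ ε * (‖x - y‖ * ‖x' - y'‖) := by
        gcongr
        rw [hε₁, div_mul_eq_mul_div, div_le_iff₀ (by positivity)]
        nlinarith

/-! ### Difference quotients of continuously differentiable curves -/

theorem hasDerivWithinAt_velocity {E : Type*} [NormedAddCommGroup E] [NormedSpace ℝ E]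
    {c : ℝ → E} (hc : IsC1Curve c) {t : ℝ} (ht : t ∈ Icc (0 : ℝ) 1) :
    HasDerivWithinAt c (velocity c t) (Icc 0 1) t :=
  (hc.2.1 t ht).hasDerivWithinAt

/-- The filter of pairs of distinct parameters in `[0, 1]` which both tend to `t`. -/
def offDiagNhds (t : ℝ) : Filter (ℝ × ℝ) :=
  𝓝[(Icc (0 : ℝ) 1).offDiag] (t, t)

theorem tendsto_fst_offDiagNhds (t : ℝ) : Tendsto Prod.fst (offDiagNhds t) (𝓝[Icc 0 1] t) :=
  tendsto_nhdsWithin_of_tendsto_nhds_of_eventually_within _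
    ((continuous_fst.tendsto (t, t)).mono_left nhdsWithin_le_nhds)
    (eventually_mem_nhdsWithin.mono fun _ h => h.1)

theorem tendsto_snd_offDiagNhds (t : ℝ) : Tendsto Prod.snd (offDiagNhds t) (𝓝[Icc 0 1] t) :=
  tendsto_nhdsWithin_of_tendsto_nhds_of_eventually_within _
    ((continuous_snd.tendsto (t, t)).mono_left nhdsWithin_le_nhds)
    (eventually_mem_nhdsWithin.mono fun _ h => h.2.1)

theorem tendsto_mk_offDiagNhds {t : ℝ} (ht : t ∈ Icc (0 : ℝ) 1) :
    Tendsto (fun s => (t, s)) (𝓝[Icc 0 1 \ {t}] t) (offDiagNhds t) :=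
  tendsto_nhdsWithin_of_tendsto_nhds_of_eventually_within _
    (((Continuous.prodMk_right t).tendsto t).mono_left nhdsWithin_le_nhds)
    (eventually_mem_nhdsWithin.mono fun _ h => ⟨ht, h.1, fun e => h.2 e.symm⟩)

theorem neBot_nhdsWithin_Icc_diff {t : ℝ} (ht : t ∈ Icc (0 : ℝ) 1) :
    (𝓝[Icc 0 1 \ {t}] t).NeBot :=
  accPt_principal_iff_nhdsWithin.1 (uniqueDiffOn_Icc_zero_one t ht).accPt

theorem offDiagNhds_neBot {t : ℝ} (ht : t ∈ Icc (0 : ℝ) 1) : (offDiagNhds t).NeBot :=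
  have := neBot_nhdsWithin_Icc_diff ht
  (tendsto_mk_offDiagNhds ht).neBot

/-- The velocity of a continuously differentiable curve is a strict derivative. -/
theorem IsC1Curve.tendsto_slope {E : Type*} [NormedAddCommGroup E] [NormedSpace ℝ E]
    {c : ℝ → E} (hc : IsC1Curve c) {t : ℝ} (ht : t ∈ Icc (0 : ℝ) 1) :
    Tendsto (fun p : ℝ × ℝ => slope c p.1 p.2) (offDiagNhds t) (𝓝 (velocity c t)) := by
  rw [Metric.tendsto_nhds]
  intro ε hε
  obtain ⟨δ, hδ, hδ'⟩ := Metric.mem_nhdsWithin_iff.1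
    (Metric.tendsto_nhds.1 (hc.2.2 t ht) (ε / 2) (half_pos hε))
  have hball : ∀ᶠ x in 𝓝[Icc 0 1] t, x ∈ Metric.ball t δ ∩ Icc 0 1 :=
    inter_mem (mem_nhdsWithin_of_mem_nhds (Metric.ball_mem_nhds t hδ)) self_mem_nhdsWithin
  filter_upwards [(tendsto_fst_offDiagNhds t).eventually hball,
    (tendsto_snd_offDiagNhds t).eventually hball, eventually_mem_nhdsWithin] with p h1 h2 h3
  have hne : p.2 - p.1 ≠ 0 := sub_ne_zero.2 h3.2.2.symm
  have hder : ∀ x ∈ Metric.ball t δ ∩ Icc 0 1, HasDerivWithinAt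
      (fun r => c r - r • velocity c t) (velocity c x - velocity c t)
      (Metric.ball t δ ∩ Icc 0 1) x := by
    intro x hx
    have h4 := (hasDerivWithinAt_id x (Metric.ball t δ ∩ Icc 0 1)).smul_const (velocity c t)
    rw [one_smul] at h4
    exact ((hasDerivWithinAt_velocity hc hx.2).mono inter_subset_right).sub h4
  have hbound : ∀ x ∈ Metric.ball t δ ∩ Icc 0 1, ‖velocity c x - velocity c t‖ ≤ ε / 2 := by
    intro x hx
    rw [← dist_eq_norm]
    exact le_of_lt (hδ' hx)
  have h5 := ((convex_ball t δ).inter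
    (convex_Icc (0 : ℝ) 1)).norm_image_sub_le_of_norm_hasDerivWithin_le hder hbound h1 h2
  have h6 : slope c p.1 p.2 - velocity c t = (p.2 - p.1)⁻¹ •
      (c p.2 - p.2 • velocity c t - (c p.1 - p.1 • velocity c t)) := by
    rw [slope_def_module]
    have : (c p.2 - p.2 • velocity c t - (c p.1 - p.1 • velocity c t))
        = (c p.2 - c p.1) - (p.2 - p.1) • velocity c t := by module
    rw [this, smul_sub _ _ ((p.2 - p.1) • _), inv_smul_smul₀ hne]
  rw [dist_eq_norm, h6, norm_smul, norm_inv]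
  have h7 : 0 < ‖p.2 - p.1‖ := norm_pos_iff.2 hne
  calc ‖p.2 - p.1‖⁻¹ * _ ≤ ‖p.2 - p.1‖⁻¹ * (ε / 2 * ‖p.2 - p.1‖) := by gcongr
    _ = ε / 2 := by field_simp
    _ < ε := half_lt_self hε

/-- A curve which is strictly differentiable at each parameter is continuously differentiable. -/
theorem isC1Curve_of_tendsto_slope {E : Type*} [NormedAddCommGroup E] [NormedSpace ℝ E]
    {c : ℝ → E} (h : ∀ t ∈ Icc (0 : ℝ) 1, ∃ v,
      Tendsto (fun p : ℝ × ℝ => slope c p.1 p.2) (offDiagNhds t) (𝓝 v)) : IsC1Curve c := by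
  choose! v hv using h
  have hder : ∀ t ∈ Icc (0 : ℝ) 1, HasDerivWithinAt c (v t) (Icc 0 1) t := fun t ht =>
    hasDerivWithinAt_iff_tendsto_slope.2 ((hv t ht).comp (tendsto_mk_offDiagNhds ht))
  have hvel : ∀ t ∈ Icc (0 : ℝ) 1, velocity c t = v t := fun t ht =>
    (hder t ht).derivWithin (uniqueDiffOn_Icc_zero_one t ht)
  refine ⟨fun t ht => (hder t ht).continuousWithinAt,
    fun t ht => (hder t ht).differentiableWithinAt, fun t ht => ?_⟩
  rw [ContinuousWithinAt, hvel t ht, Metric.tendsto_nhds]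
  intro ε hε
  have h1 := Metric.tendsto_nhds.1 (hv t ht) (ε / 2) (half_pos hε)
  rw [offDiagNhds, eventually_nhdsWithin_iff, nhds_prod_eq] at h1
  obtain ⟨U, hU, hU'⟩ := mem_prod_self_iff.1 h1
  obtain ⟨O, hOU, hO, htO⟩ := mem_nhds_iff.1 hU
  filter_upwards [mem_nhdsWithin_of_mem_nhds (hO.mem_nhds htO), eventually_mem_nhdsWithin]
    with r hrO hr
  -- the slopes at `r` are close to `v t`, hence so is their limit
  have := neBot_nhdsWithin_Icc_diff hr
  have h2 : v r ∈ Metric.closedBall (v t) (ε / 2) := by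
    refine Metric.isClosed_closedBall.mem_of_tendsto
      ((hv r hr).comp (tendsto_mk_offDiagNhds hr)) ?_
    filter_upwards [mem_nhdsWithin_of_mem_nhds (hO.mem_nhds hrO), eventually_mem_nhdsWithin]
      with s hsO hs
    exact (hU' (mk_mem_prod (hOU hrO) (hOU hsO)) ⟨hr, hs.1, fun e => hs.2 e.symm⟩ : _ < _).le
  rw [hvel r hr]
  exact (Metric.mem_closedBall.1 h2).trans_lt (half_lt_self hε)

/-! ### Families of vectors with asymptotically related inner products -/

section Gram

variable {E G T T' : Type*} [NormedAddCommGroup E] [InnerProductSpace ℝ E]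
  [NormedAddCommGroup G] [InnerProductSpace ℝ G] {l : Filter T} {l' : Filter T'}
  {A : E →L[ℝ] E} {q : T → E} {q' : T' → E} {Q : T → G} {Q' : T' → G}

/-- The inner products of the families `Q`, `Q'` are asymptotically those of `q`, `q'` in the
bilinear form `⟨v, A w⟩`. -/
def IsGramEquivalent (A : E →L[ℝ] E) (l : Filter T) (l' : Filter T') (q : T → E) (q' : T' → E)
    (Q : T → G) (Q' : T' → G) : Prop :=
  (fun p : T × T' => inner ℝ (Q p.1) (Q' p.2) - inner ℝ (q p.1) (A (q' p.2))) =o[l ×ˢ l']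
    fun p => ‖q p.1‖ * ‖q' p.2‖

/-- For bounded families `q` and `q'`, the error is absolutely small. -/
theorem IsGramEquivalent.tendsto_sub (h : IsGramEquivalent A l l' q q' Q Q')
    (hq : l.IsBoundedUnder (· ≤ ·) fun a => ‖q a‖)
    (hq' : l'.IsBoundedUnder (· ≤ ·) fun a => ‖q' a‖) :
    Tendsto (fun p : T × T' => inner ℝ (Q p.1) (Q' p.2) - inner ℝ (q p.1) (A (q' p.2)))
      (l ×ˢ l') (𝓝 0) := by
  obtain ⟨R, hR⟩ := hq
  obtain ⟨R', hR'⟩ := hq'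
  rw [eventually_map] at hR hR'
  rw [← Asymptotics.isLittleO_one_iff ℝ]
  refine h.trans_isBigO (Asymptotics.IsBigO.of_bound (R * R') ?_)
  filter_upwards [hR.prod_inl l', hR'.prod_inr l] with p h1 h2
  rw [norm_mul, norm_norm, norm_norm, norm_one, mul_one]
  exact mul_le_mul h1 h2 (norm_nonneg _) ((norm_nonneg _).trans h1)

theorem IsGramEquivalent.tendsto_inner (h : IsGramEquivalent A l l' q q' Q Q') {v v' : E}
    (hq : Tendsto q l (𝓝 v)) (hq' : Tendsto q' l' (𝓝 v')) :
    Tendsto (fun p : T × T' => inner ℝ (Q p.1) (Q' p.2)) (l ×ˢ l') (𝓝 (inner ℝ v (A v'))) := by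
  have h1 := h.tendsto_sub hq.norm.isBoundedUnder_le hq'.norm.isBoundedUnder_le
  have h2 : Tendsto (fun p : T × T' => inner ℝ (q p.1) (A (q' p.2))) (l ×ˢ l')
      (𝓝 (inner ℝ v (A v'))) :=
    (hq.comp tendsto_fst).inner ((A.continuous.tendsto v').comp (hq'.comp tendsto_snd))
  simpa using h1.add h2

theorem IsGramEquivalent.inner_eq [l.NeBot] [l'.NeBot] (h : IsGramEquivalent A l l' q q' Q Q')
    {v v' : E} {w w' : G} (hq : Tendsto q l (𝓝 v)) (hq' : Tendsto q' l' (𝓝 v'))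
    (hQ : Tendsto Q l (𝓝 w)) (hQ' : Tendsto Q' l' (𝓝 w')) :
    inner ℝ w w' = inner ℝ v (A v') :=
  tendsto_nhds_unique ((hQ.comp tendsto_fst).inner (hQ'.comp tendsto_snd))
    (h.tendsto_inner hq hq')

theorem exists_tendsto_of_tendsto_norm_sub_sq {H : Type*} [NormedAddCommGroup H] [CompleteSpace H]
    [l.NeBot] {Q : T → H}
    (h : Tendsto (fun p : T × T => ‖Q p.1 - Q p.2‖ ^ 2) (l ×ˢ l) (𝓝 0)) :
    ∃ w, Tendsto Q l (𝓝 w) := by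
  rw [← cauchy_map_iff_exists_tendsto, cauchy_map_iff]
  refine ⟨inferInstance, ?_⟩
  rw [Metric.uniformity_eq_comap_nhds_zero, tendsto_comap_iff]
  have := h.sqrt
  simpa [Function.comp_def, dist_eq_norm, Real.sqrt_sq] using this

/-- Second differences of a convergent double family tend to `0`. With inner products for `g`, the
second difference is the squared norm (or the quadratic form) of an increment. -/
theorem Filter.Tendsto.second_difference {g : T × T → ℝ} {L : ℝ}
    (h : Tendsto g (l ×ˢ l) (𝓝 L)) :
    Tendsto (fun p : T × T => g (p.1, p.1) - g (p.1, p.2) - (g (p.2, p.1) - g (p.2, p.2)))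
      (l ×ˢ l) (𝓝 0) := by
  have h11 : Tendsto (fun p : T × T => g (p.1, p.1)) (l ×ˢ l) (𝓝 L) :=
    h.comp (tendsto_fst.prodMk tendsto_fst)
  have h22 : Tendsto (fun p : T × T => g (p.2, p.2)) (l ×ˢ l) (𝓝 L) :=
    h.comp (tendsto_snd.prodMk tendsto_snd)
  have h21 : Tendsto (fun p : T × T => g (p.2, p.1)) (l ×ˢ l) (𝓝 L) :=
    h.comp (tendsto_snd.prodMk tendsto_fst)
  simpa using (h11.sub h).sub (h21.sub h22)

theorem IsGramEquivalent.exists_tendsto [CompleteSpace G] [l.NeBot]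
    (h : IsGramEquivalent A l l q q Q Q) {v : E} (hq : Tendsto q l (𝓝 v)) :
    ∃ w, Tendsto Q l (𝓝 w) := by
  refine exists_tendsto_of_tendsto_norm_sub_sq ((h.tendsto_inner hq hq).second_difference.congr ?_)
  intro p
  rw [← real_inner_self_eq_norm_sq, inner_sub_left, inner_sub_right, inner_sub_right]

/-- If the form `⟨v, A v⟩` is coercive, convergence passes from `Q` back to `q`. Coercivity also
gives the boundedness of `q`, without which the relative error would not be small. -/
theorem IsGramEquivalent.exists_tendsto_of_coercive [CompleteSpace E] [l.NeBot]
    (h : IsGramEquivalent A l l q q Q Q) {c : ℝ} (hc : 0 < c)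
    (hA : ∀ v, c * ‖v‖ ^ 2 ≤ inner ℝ v (A v)) {w : G} (hQ : Tendsto Q l (𝓝 w)) :
    ∃ v, Tendsto q l (𝓝 v) := by
  have hbdd : l.IsBoundedUnder (· ≤ ·) fun a => ‖q a‖ := by
    obtain ⟨R, hR⟩ := hQ.norm.isBoundedUnder_le
    rw [eventually_map] at hR
    refine ⟨√(2 * R ^ 2 / c), ?_⟩
    rw [eventually_map]
    have hdiag : Tendsto (fun a => (a, a)) l (l ×ˢ l) := tendsto_id.prodMk tendsto_id
    filter_upwards [hR, hdiag.eventually (Asymptotics.isLittleO_iff.1 h (half_pos hc))]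
      with a h1 h2
    rw [real_inner_self_eq_norm_sq, norm_mul, norm_norm, Real.norm_eq_abs] at h2
    have h3 := hA (q a)
    have h4 := (abs_le.1 h2).1
    have h5 : ‖Q a‖ ^ 2 ≤ R ^ 2 := pow_le_pow_left₀ (norm_nonneg _) h1 2
    refine Real.le_sqrt_of_sq_le ?_
    rw [le_div_iff₀ hc]
    nlinarith
  have hQ2 : Tendsto (fun p : T × T => inner ℝ (Q p.1) (Q p.2)) (l ×ˢ l) (𝓝 (inner ℝ w w)) :=
    (hQ.comp tendsto_fst).inner (hQ.comp tendsto_snd)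
  have hq2 : Tendsto (fun p : T × T => inner ℝ (q p.1) (A (q p.2))) (l ×ˢ l)
      (𝓝 (inner ℝ w w)) := by
    simpa using hQ2.sub (h.tendsto_sub hbdd hbdd)
  have hdiff := hq2.second_difference.const_mul c⁻¹
  rw [mul_zero] at hdiff
  refine exists_tendsto_of_tendsto_norm_sub_sq (squeeze_zero (fun _ => by positivity) ?_ hdiff)
  intro p
  have h1 := hA (q p.1 - q p.2)
  rw [map_sub, inner_sub_left, inner_sub_right, inner_sub_right] at h1
  rw [inv_mul_eq_div, le_div_iff₀ hc, mul_comm]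
  exact h1

end Gram

/-- A form which is positive away from `0` on a finite-dimensional space is coercive. -/
theorem exists_coercive_of_pos {E : Type*} [NormedAddCommGroup E] [InnerProductSpace ℝ E]
    [FiniteDimensional ℝ E] {A : E →L[ℝ] E} (hA : ∀ v ≠ 0, 0 < inner ℝ v (A v)) :
    ∃ c > 0, ∀ v, c * ‖v‖ ^ 2 ≤ inner ℝ v (A v) := by
  rcases subsingleton_or_nontrivial E with hE | hE
  · exact ⟨1, one_pos, fun v => by simp [Subsingleton.elim v 0]⟩
  obtain ⟨v₀, hv₀, hmin⟩ := (isCompact_sphere (0 : E) 1).exists_isMinOn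
    (NormedSpace.sphere_nonempty.2 zero_le_one)
    (f := fun v => inner ℝ v (A v)) (by fun_prop)
  have hv₀' : ‖v₀‖ = 1 := by simpa using hv₀
  refine ⟨_, hA v₀ (fun h => by simp [h] at hv₀'), fun v => ?_⟩
  by_cases hv : v = 0
  · simp [hv]
  have hn : 0 < ‖v‖ := norm_pos_iff.2 hv
  have h1 := isMinOn_iff.1 hmin (‖v‖⁻¹ • v) (by simp [norm_smul, hn.ne'])
  simp only [map_smul, real_inner_smul_left, real_inner_smul_right] at h1
  calc inner ℝ v₀ (A v₀) * ‖v‖ ^ 2 ≤ ‖v‖⁻¹ * (‖v‖⁻¹ * inner ℝ v (A v)) * ‖v‖ ^ 2 := by gcongr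
    _ = inner ℝ v (A v) := by field_simp

/-! ### The feature map -/

theorem inner_mercerFeatureMap {S : Type*} [MeasurableSpace S] {μ : Measure S} {f : S → S → ℝ}
    {lam : ℕ → ℝ} {u : ℕ → S → ℝ} (h : IsMercerSystem μ f lam u) (z z' : S) :
    inner ℝ (mercerFeatureMap h z) (mercerFeatureMap h z') = f z z' := by
  refine (lp.hasSum_inner _ _).unique ((h.hasSum z z').congr_fun ?_)
  intro k
  have h1 := Real.mul_self_sqrt (h.nonneg k)
  simp only [mercerFeatureMap, RCLike.inner_apply, conj_trivial]
  linear_combination (u k z * u k z') * h1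

/-- A map into an inner product space is continuous if its kernel is. -/
theorem continuous_of_continuous_inner {S G : Type*} [TopologicalSpace S] [NormedAddCommGroup G]
    [InnerProductSpace ℝ G] {φ : S → G}
    (h : Continuous fun q : S × S => inner ℝ (φ q.1) (φ q.2)) : Continuous φ := by
  rw [continuous_iff_continuousAt]
  intro z
  rw [ContinuousAt, tendsto_iff_norm_sub_tendsto_zero]
  have h1 : Continuous fun w => inner ℝ (φ w) (φ w) - inner ℝ (φ w) (φ z)
      - (inner ℝ (φ z) (φ w) - inner ℝ (φ z) (φ z)) :=
    ((h.comp (Continuous.prodMk continuous_id continuous_id)).sub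
      (h.comp (Continuous.prodMk continuous_id continuous_const))).sub
      ((h.comp (Continuous.prodMk continuous_const continuous_id)).sub continuous_const)
  have h2 := (h1.tendsto z).sqrt
  simp only [sub_self, Real.sqrt_zero] at h2
  refine h2.congr fun w => ?_
  rw [← Real.sqrt_sq (norm_nonneg (φ w - φ z)), ← real_inner_self_eq_norm_sq, inner_sub_left,
    inner_sub_right, inner_sub_right]

/-- The matrix `H_ξ` as a continuous linear operator. -/
noncomputable def metricOperator {n : ℕ}
    (F : EuclideanSpace ℝ (Fin n) → EuclideanSpace ℝ (Fin n) → ℝ)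
    (ξ : EuclideanSpace ℝ (Fin n)) : EuclideanSpace ℝ (Fin n) →L[ℝ] EuclideanSpace ℝ (Fin n) :=
  LinearMap.toContinuousLinearMap (Matrix.toEuclideanLin (metricMatrix F ξ))

theorem inner_metricOperator {n : ℕ}
    (F : EuclideanSpace ℝ (Fin n) → EuclideanSpace ℝ (Fin n) → ℝ)
    (ξ v w : EuclideanSpace ℝ (Fin n)) :
    inner ℝ v (metricOperator F ξ w) = metricForm F ξ v w := rfl

theorem exists_coercive_metricOperator {n : ℕ}
    {F : EuclideanSpace ℝ (Fin n) → EuclideanSpace ℝ (Fin n) → ℝ}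
    {ξ : EuclideanSpace ℝ (Fin n)} (h : (metricMatrix F ξ).PosDef) :
    ∃ c > 0, ∀ v, c * ‖v‖ ^ 2 ≤ inner ℝ v (metricOperator F ξ v) := by
  refine exists_coercive_of_pos fun v hv => ?_
  have h1 := h.dotProduct_mulVec_pos (x := v.ofLp) (by simpa using hv)
  rw [inner_metricOperator]
  simpa [metricForm, PiLp.inner_apply, Matrix.toLpLin_apply, dotProduct, mul_comm] using h1

/-! ### Curves and the feature map -/

section Curves

variable {n : ℕ} {Z : Set (EuclideanSpace ℝ (Fin n))} {f : Z → Z → ℝ}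
  {Zt : Set (EuclideanSpace ℝ (Fin n))}
  {F : EuclideanSpace ℝ (Fin n) → EuclideanSpace ℝ (Fin n) → ℝ}
  {G : Type*} [NormedAddCommGroup G] [InnerProductSpace ℝ G] {φ : Z → G}

/-- The slopes of `η` and of `φ ∘ η` have asymptotically the same inner products, those of `η`
being measured by the form `H`. -/
theorem isGramEquivalent_slope (hF : IsKernelExtension Z f Zt F)
    (hφ : ∀ z z', inner ℝ (φ z) (φ z') = f z z') {η η' : ℝ → Z} {t s : ℝ}
    (hη : ContinuousWithinAt η (Icc 0 1) t) (hη' : ContinuousWithinAt η' (Icc 0 1) s)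
    (hts : η t = η' s) :
    IsGramEquivalent (metricOperator F (η t)) (offDiagNhds t) (offDiagNhds s)
      (fun p => slope (fun r => (η r : EuclideanSpace ℝ (Fin n))) p.1 p.2)
      (fun p => slope (fun r => (η' r : EuclideanSpace ℝ (Fin n))) p.1 p.2)
      (fun p => slope (fun r => φ (η r)) p.1 p.2)
      (fun p => slope (fun r => φ (η' r)) p.1 p.2) := by
  rw [IsGramEquivalent, Asymptotics.isLittleO_iff]
  intro ε hε
  obtain ⟨U, hU, hU'⟩ := eventually_smallSets.1
    (hF.exists_second_difference_le (hF.subset (η t).2) hε)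
  have hηU : ∀ᶠ r in 𝓝[Icc 0 1] t, (η r : EuclideanSpace ℝ (Fin n)) ∈ U :=
    ((continuous_subtype_val.tendsto _).comp hη).eventually hU
  have hηU' : ∀ᶠ r in 𝓝[Icc 0 1] s, (η' r : EuclideanSpace ℝ (Fin n)) ∈ U := by
    rw [hts] at hU
    exact ((continuous_subtype_val.tendsto _).comp hη').eventually hU
  filter_upwards [((tendsto_fst_offDiagNhds t).eventually hηU).prod_inl (offDiagNhds s),
    ((tendsto_snd_offDiagNhds t).eventually hηU).prod_inl (offDiagNhds s),
    ((tendsto_fst_offDiagNhds s).eventually hηU').prod_inr (offDiagNhds t),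
    ((tendsto_snd_offDiagNhds s).eventually hηU').prod_inr (offDiagNhds t)] with p h1 h2 h3 h4
  have h5 := hU' U subset_rfl _ h2 _ h1 _ h4 _ h3
  simp only [hF.extends_kernel, ← hφ] at h5
  rw [← inner_metricOperator] at h5
  simp only [slope_def_module, map_smul, real_inner_smul_left, real_inner_smul_right, norm_smul]
  set a := (p.1.2 - p.1.1)⁻¹
  set b := (p.2.2 - p.2.1)⁻¹
  have h6 : inner ℝ (φ (η p.1.2) - φ (η p.1.1)) (φ (η' p.2.2) - φ (η' p.2.1)) =
      inner ℝ (φ (η p.1.2)) (φ (η' p.2.2)) - inner ℝ (φ (η p.1.1)) (φ (η' p.2.2)) -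
      (inner ℝ (φ (η p.1.2)) (φ (η' p.2.1)) - inner ℝ (φ (η p.1.1)) (φ (η' p.2.1))) := by
    rw [inner_sub_right, inner_sub_left, inner_sub_left]
  rw [← h6] at h5
  simp only [← mul_sub, norm_mul, norm_norm]
  calc _ ≤ ‖b‖ * (‖a‖ * _) :=
        mul_le_mul_of_nonneg_left (mul_le_mul_of_nonneg_left h5 (norm_nonneg _)) (norm_nonneg _)
    _ = _ := by ring

theorem continuousOn_of_isC1Curve {η : ℝ → Z}
    (hη : IsC1Curve fun t => (η t : EuclideanSpace ℝ (Fin n))) : ContinuousOn η (Icc 0 1) :=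
  continuousOn_iff_continuous_domRestrict.2
    ((continuousOn_iff_continuous_domRestrict.1 hη.1).subtype_mk fun t => (η t).2)

theorem isC1Curve_comp [CompleteSpace G] (hF : IsKernelExtension Z f Zt F)
    (hφ : ∀ z z', inner ℝ (φ z) (φ z') = f z z') {η : ℝ → Z}
    (hη : IsC1Curve fun t => (η t : EuclideanSpace ℝ (Fin n))) :
    IsC1Curve fun t => φ (η t) :=
  isC1Curve_of_tendsto_slope fun t ht =>
    have := offDiagNhds_neBot ht
    have hc := continuousOn_of_isC1Curve hη t ht
    (isGramEquivalent_slope hF hφ hc hc rfl).exists_tendsto (hη.tendsto_slope ht)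

/-- The direction from `φ ∘ η` to `η`, where positive definiteness of `H` enters. -/
theorem isC1Curve_of_comp (hF : IsKernelExtension Z f Zt F)
    (hφ : ∀ z z', inner ℝ (φ z) (φ z') = f z z') (hemb : IsEmbedding φ) {η : ℝ → Z}
    (hη : IsC1Curve fun t => φ (η t)) :
    IsC1Curve fun t => (η t : EuclideanSpace ℝ (Fin n)) :=
  isC1Curve_of_tendsto_slope fun t ht => by
    have := offDiagNhds_neBot ht
    have hc : ContinuousWithinAt η (Icc 0 1) t := hemb.tendsto_nhds_iff.2 (hη.1 t ht)
    obtain ⟨c, hc0, hA⟩ := exists_coercive_metricOperator (hF.posDef _ (η t).2)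
    exact (isGramEquivalent_slope hF hφ hc hc rfl).exists_tendsto_of_coercive hc0 hA
      (hη.tendsto_slope ht)

theorem inner_velocity_comp [CompleteSpace G] (hF : IsKernelExtension Z f Zt F)
    (hφ : ∀ z z', inner ℝ (φ z) (φ z') = f z z') {η η' : ℝ → Z}
    (hη : IsC1Curve fun t => (η t : EuclideanSpace ℝ (Fin n)))
    (hη' : IsC1Curve fun t => (η' t : EuclideanSpace ℝ (Fin n))) {t s : ℝ}
    (ht : t ∈ Icc (0 : ℝ) 1) (hs : s ∈ Icc (0 : ℝ) 1) (hts : η t = η' s) :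
    inner ℝ (velocity (fun r => φ (η r)) t) (velocity (fun r => φ (η' r)) s) =
      metricForm F (η t) (velocity (fun r => (η r : EuclideanSpace ℝ (Fin n))) t)
        (velocity (fun r => (η' r : EuclideanSpace ℝ (Fin n))) s) :=
  have := offDiagNhds_neBot ht
  have := offDiagNhds_neBot hs
  (isGramEquivalent_slope hF hφ (continuousOn_of_isC1Curve hη t ht)
    (continuousOn_of_isC1Curve hη' s hs) hts).inner_eq (hη.tendsto_slope ht)
    (hη'.tendsto_slope hs) ((isC1Curve_comp hF hφ hη).tendsto_slope ht)
    ((isC1Curve_comp hF hφ hη').tendsto_slope hs)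

theorem integral_norm_velocity_comp [CompleteSpace G] (hF : IsKernelExtension Z f Zt F)
    (hφ : ∀ z z', inner ℝ (φ z) (φ z') = f z z') {η : ℝ → Z}
    (hη : IsC1Curve fun t => (η t : EuclideanSpace ℝ (Fin n))) :
    ∫ t in (0 : ℝ)..1, ‖velocity (fun s => φ (η s)) t‖ =
      ∫ t in (0 : ℝ)..1, √(metricForm F (η t)
        (velocity (fun s => (η s : EuclideanSpace ℝ (Fin n))) t)
        (velocity (fun s => (η s : EuclideanSpace ℝ (Fin n))) t)) := by
  refine intervalIntegral.integral_congr fun t ht => ?_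
  rw [uIcc_of_le zero_le_one] at ht
  rw [← inner_velocity_comp hF hφ hη hη ht ht rfl, real_inner_self_eq_norm_sq,
    Real.sqrt_sq (norm_nonneg _)]

end Curves

/-! ### The feature map is an isometry for the metric `H` -/

theorem proposition3 {Ω : Type*} [MeasurableSpace Ω] (P : Measure Ω) [IsProbabilityMeasure P]
    {d dt : ℕ} (hd : d ≤ dt)
    -- the latent metric space
    (Z : Set (EuclideanSpace ℝ (Fin dt))) (hZ : IsCompact Z) (hZd : IsDifferentiableManifold d Z)
    (μ : Measure Z) [IsProbabilityMeasure μ]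
    -- the square-integrable random fields, with continuous covariances
    {p : ℕ} (hp : 0 < p) (X : Fin p → Z → Ω → ℝ) (hX : ∀ j z, MemLp (X j z) 2 P)
    (hXc : ∀ j, Continuous fun q : Z × Z => ∫ ω, X j q.1 ω * X j q.2 ω ∂P)
    -- the kernel distinguishes the points of the latent space
    (hinj : ∀ z z' : Z, z ≠ z' →
      ∃ ξ : Z, meanCorrelationKernel P X z ξ ≠ meanCorrelationKernel P X z' ξ)
    -- the differentiable extension of the kernel
    (Zt : Set (EuclideanSpace ℝ (Fin dt)))
    (F : EuclideanSpace ℝ (Fin dt) → EuclideanSpace ℝ (Fin dt) → ℝ)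
    (hF : IsKernelExtension Z (meanCorrelationKernel P X) Zt F)
    -- the Mercer feature map
    (lam : ℕ → ℝ) (u : ℕ → Z → ℝ)
    (hlu : IsMercerSystem μ (meanCorrelationKernel P X) lam u)
    (φ : Z → lp (fun _ : ℕ => ℝ) 2) (hφ : φ = mercerFeatureMap hlu) :
    -- `φ` is a homeomorphism onto its image `M`, so that `φ⁻¹ : M → Z` makes sense
    IsEmbedding φ ∧
    -- curves in `Z` are mapped to curves in `M`
    (∀ η : ℝ → Z, IsC1Curve (fun t => (η t : EuclideanSpace ℝ (Fin dt))) →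
      IsC1Curve fun t => φ (η t)) ∧
    -- curves in `M` are mapped by `φ⁻¹` to curves in `Z`
    (∀ γ : ℝ → range φ, IsC1Curve (fun t => (γ t : lp (fun _ : ℕ => ℝ) 2)) →
      IsC1Curve fun t => (rangeSplitting φ (γ t)).1) ∧
    -- the length identity, starting from a curve in `Z`
    (∀ η : ℝ → Z, IsC1Curve (fun t => (η t : EuclideanSpace ℝ (Fin dt))) →
      ∫ t in (0 : ℝ)..1, ‖velocity (fun s => φ (η s)) t‖ =
        ∫ t in (0 : ℝ)..1, √(metricForm F (η t)
          (velocity (fun s => (η s : EuclideanSpace ℝ (Fin dt))) t)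
          (velocity (fun s => (η s : EuclideanSpace ℝ (Fin dt))) t))) ∧
    -- the length identity, starting from a curve in `M`
    (∀ γ : ℝ → range φ, IsC1Curve (fun t => (γ t : lp (fun _ : ℕ => ℝ) 2)) →
      ∫ t in (0 : ℝ)..1, ‖velocity (fun s => (γ s : lp (fun _ : ℕ => ℝ) 2)) t‖ =
        ∫ t in (0 : ℝ)..1, √(metricForm F (rangeSplitting φ (γ t)).1
          (velocity (fun s => (rangeSplitting φ (γ s)).1) t)
          (velocity (fun s => (rangeSplitting φ (γ s)).1) t))) ∧
    -- `H` is the metric pulled back from `ℓ₂`: velocities of curves through a common point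
    (∀ η η' : ℝ → Z, IsC1Curve (fun t => (η t : EuclideanSpace ℝ (Fin dt))) →
      IsC1Curve (fun t => (η' t : EuclideanSpace ℝ (Fin dt))) →
      ∀ t ∈ Icc (0 : ℝ) 1, ∀ s ∈ Icc (0 : ℝ) 1, η t = η' s →
        inner ℝ (velocity (fun r => φ (η r)) t) (velocity (fun r => φ (η' r)) s) =
          metricForm F (η t)
            (velocity (fun r => (η r : EuclideanSpace ℝ (Fin dt))) t)
            (velocity (fun r => (η' r : EuclideanSpace ℝ (Fin dt))) s)) := by
  have hin : ∀ z z', inner ℝ (φ z) (φ z') = meanCorrelationKernel P X z z' := by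
    rw [hφ]
    exact inner_mercerFeatureMap hlu
  have hcont : Continuous φ := by
    refine continuous_of_continuous_inner ?_
    simp only [hin, meanCorrelationKernel]
    exact continuous_const.mul (continuous_finsetSum _ fun j _ => hXc j)
  have hφinj : Function.Injective φ := by
    intro z z' h
    by_contra hne
    obtain ⟨ξ, hξ⟩ := hinj z z' hne
    exact hξ (by rw [← hin, ← hin, h])
  have : CompactSpace Z := isCompact_iff_compactSpace.1 hZ
  have hemb : IsEmbedding φ := (hcont.isClosedEmbedding hφinj).isEmbedding
  have hsplit : ∀ γ : ℝ → range φ,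
      (fun t => φ (rangeSplitting φ (γ t))) = fun t => (γ t : lp (fun _ : ℕ => ℝ) 2) :=
    fun γ => funext fun t => apply_rangeSplitting φ (γ t)
  have hback : ∀ γ : ℝ → range φ, IsC1Curve (fun t => (γ t : lp (fun _ : ℕ => ℝ) 2)) →
      IsC1Curve fun t => (rangeSplitting φ (γ t)).1 := fun γ hγ =>
    isC1Curve_of_comp hF hin hemb (η := fun t => rangeSplitting φ (γ t)) (by rwa [hsplit γ])
  refine ⟨hemb, fun η hη => isC1Curve_comp hF hin hη, hback,
    fun η hη => integral_norm_velocity_comp hF hin hη, fun γ hγ => ?_,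
    fun η η' hη hη' t ht s hs hts => inner_velocity_comp hF hin hη hη' ht hs hts⟩
  have h := integral_norm_velocity_comp hF hin (hback γ hγ)
  rwa [hsplit γ] at h
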